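/- Let $R$ be a commutative Noetherian local integral domain of Krull dimension one, and let $M$ be a nonzero finitely generated $R$-module. Assume that $M$ is two-periodic, i.e. $M \cong \Omega^2_R M$, where $\Omega^2_R M$ denotes the image of the second differential $F_2 \to F_1$ of a minimal free resolution $\cdots \to F_2 \to F_1 \to F_0 \to M \to 0$ of $M$. Then the torsion submodule of $M \otimes_R M^{\ast}$ is nonzero, where $M^{\ast} = \operatorname{Hom}_R(M,R)$. -/

import Mathlib

open scoped TensorProduct

/-- A minimal free resolution, by finitely generated free modules, of a module `M` over a local
ring `R`:
`⋯ ⟶ R ^ rk 2 ⟶ R ^ rk 1 ⟶ R ^ rk 0 ⟶ M ⟶ 0`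
is exact and every differential maps into the maximal ideal times its target.
The map `d n : R ^ rk (n + 1) ⟶ R ^ rk n` is the differential number `n + 1`. -/
structure MinimalFreeResolution (R : Type*) [CommRing R] [IsLocalRing R]
    (M : Type*) [AddCommGroup M] [Module R M] where
  /-- The rank of the free module in degree `n`. -/
  rk : ℕ → ℕ
  /-- The differential from degree `n + 1` to degree `n`. -/
  d : ∀ n : ℕ, (Fin (rk (n + 1)) → R) →ₗ[R] (Fin (rk n) → R)
  /-- The augmentation. -/
  ε : (Fin (rk 0) → R) →ₗ[R] M
  surjective_ε : Function.Surjective ε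
  exact_ε : Function.Exact (d 0) ε
  exact_d : ∀ n : ℕ, Function.Exact (d (n + 1)) (d n)
  minimal : ∀ n : ℕ, LinearMap.range (d n) ≤
    IsLocalRing.maximalIdeal R • (⊤ : Submodule R (Fin (rk n) → R))

/-- `IsSyzygy R n M N` says that `N` is isomorphic to the syzygy `Ωⁿ M`: to `M` itself if `n = 0`,
and to the image of the differential number `n` of a minimal free resolution of `M` if `n > 0`. -/
def IsSyzygy (R : Type*) [CommRing R] [IsLocalRing R] (n : ℕ)
    (M : Type*) [AddCommGroup M] [Module R M] (N : Type*) [AddCommGroup N] [Module R N] : Prop :=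
  match n with
  | 0 => Nonempty (N ≃ₗ[R] M)
  | n + 1 => ∃ F : MinimalFreeResolution R M, Nonempty (N ≃ₗ[R] LinearMap.range (F.d n))

/-- A module `M` is two-periodic if `M ≅ Ω² M`. -/
def IsTwoPeriodic (R : Type*) [CommRing R] [IsLocalRing R]
    (M : Type*) [AddCommGroup M] [Module R M] : Prop :=
  IsSyzygy R 2 M M

/-! Splicing 0 → M → F₁ → F₀ → M → 0 with itself gives a two-periodic exact complex with maps A : F₁
→ F₀ and B = i ∘ ε : F₀ → F₁. Suppose M ⊗ M* is torsion-free. The kernel of M* ⊗ i is torsion, hence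
zero, so M* ⊗ F is exact at F₀. A Herbrand quotient argument (`exact_lTensor_of_exact_lTensor`)
gives exactness at F₁ too: modulo a free submodule, M* has finite length, and F₀, F₁ have equal
rank.

Since M* ⊗ Fⱼ = Hom(M, Fⱼ) and A ∘ i = 0, exactness at F₁ gives i = B ∘ s = i ∘ ε ∘ s. Thus ε
splits, which minimality forbids unless F₁ = 0, and then M = 0. -/

open Function

/-! ### Finite length and torsion over a one-dimensional domain -/

/-- A finitely generated module killed by a nonzero element of a one-dimensional Noetherian domain
has finite length. -/
theorem isFiniteLength_of_forall_smul_eq_zero {R : Type*} [CommRing R] [IsDomain R]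
    [IsNoetherianRing R] [Ring.KrullDimLE 1 R] {C : Type*} [AddCommGroup C] [Module R C]
    [Module.Finite R C] {c : R} (hc : c ≠ 0) (h : ∀ x : C, c • x = 0) : IsFiniteLength R C := by
  have hq := isFiniteLength_quotient_span_singleton R (mem_nonZeroDivisors_of_ne_zero hc)
  rw [isFiniteLength_iff_isNoetherian_isArtinian] at hq ⊢
  refine ⟨inferInstance, ?_⟩
  obtain ⟨n, f, hf⟩ := Module.Finite.exists_fin' R C
  have := hq.2
  let π : (Fin n → R) →ₗ[R] (Fin n → R ⧸ Ideal.span {c}) :=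
    LinearMap.pi fun i ↦ (Submodule.mkQ (Ideal.span {c})) ∘ₗ LinearMap.proj i
  have hπ : Surjective π := fun y ↦ by
    choose x hx using fun i ↦ Submodule.mkQ_surjective _ (y i)
    exact ⟨x, funext hx⟩
  -- The kernel of `π` is c·Rⁿ, which `f` sends into c·C = 0.
  have hker : LinearMap.ker π ≤ LinearMap.ker f := fun x hx ↦ by
    have hx' : ∀ i, ∃ a, c * a = x i := fun i ↦ by
      have hi : Submodule.mkQ (Ideal.span {c}) (x i) = 0 := congrFun (LinearMap.mem_ker.mp hx) i
      rw [Submodule.mkQ_apply, Submodule.Quotient.mk_eq_zero, Ideal.mem_span_singleton] at hi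
      obtain ⟨a, ha⟩ := hi
      exact ⟨a, ha.symm⟩
    choose a ha using hx'
    have : x = c • a := funext fun i ↦ (ha i).symm
    rw [LinearMap.mem_ker, this, map_smul, h]
  refine isArtinian_of_surjective _
    ((LinearMap.ker π).liftQ f hker ∘ₗ (π.quotKerEquivOfSurjective hπ).symm.toLinearMap) ?_
  intro y
  obtain ⟨x, rfl⟩ := hf y
  refine ⟨π x, ?_⟩
  have : (π.quotKerEquivOfSurjective hπ).symm (π x) = Submodule.Quotient.mk x := by
    rw [LinearEquiv.symm_apply_eq]; rfl
  simp only [LinearMap.comp_apply, LinearEquiv.coe_coe, this, Submodule.liftQ_apply]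

/-- A finitely generated module over a Noetherian domain contains a flat submodule which contains a
nonzero multiple of the whole module. -/
theorem exists_flat_submodule_smul_mem (R : Type*) [CommRing R] [IsDomain R]
    (X : Type*) [AddCommGroup X] [Module R X] [Module.Finite R X] :
    ∃ L : Submodule R X, Module.Flat R L ∧ ∃ c : R, c ≠ 0 ∧ ∀ x : X, c • x ∈ L := by
  -- Maximality of `s` makes the quotient by its free span torsion.
  obtain ⟨s, hs, hmax⟩ := exists_maximal_linearIndepOn R (id : X → X)
  have hfree : Module.Free R (Submodule.span R (Set.range fun i : s ↦ id (i : X))) :=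
    Module.Free.of_basis (Module.Basis.span hs)
  refine ⟨_, @Module.Flat.of_free _ _ _ _ _ hfree, ?_⟩
  set L := Submodule.span R (Set.range fun i : s ↦ id (i : X)) with hL
  have htors : Module.IsTorsion R (X ⧸ L) := fun {q} ↦ by
    obtain ⟨x, rfl⟩ := Submodule.mkQ_surjective _ q
    by_cases hx : x ∈ s
    · refine ⟨1, ?_⟩
      rw [one_smul, Submodule.mkQ_apply, Submodule.Quotient.mk_eq_zero]
      exact Submodule.subset_span ⟨⟨x, hx⟩, rfl⟩
    · obtain ⟨a, ha, hmem⟩ := hmax x hx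
      refine ⟨⟨a, mem_nonZeroDivisors_of_ne_zero ha⟩, ?_⟩
      rw [Submonoid.mk_smul, ← map_smul, Submodule.mkQ_apply, Submodule.Quotient.mk_eq_zero, hL]
      rwa [Set.image_eq_range] at hmem
  obtain ⟨c, hc, hc0⟩ := Submodule.annihilator_top_inter_nonZeroDivisors htors
  refine ⟨c, nonZeroDivisors.ne_zero hc0, fun x ↦ ?_⟩
  rw [← Submodule.Quotient.mk_eq_zero, Submodule.Quotient.mk_smul]
  exact Submodule.mem_annihilator.mp hc _ trivial

theorem LinearMap.length_range_add_length_ker {R V W : Type*} [Ring R] [AddCommGroup V]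
    [AddCommGroup W] [Module R V] [Module R W] (f : V →ₗ[R] W) :
    Module.length R (LinearMap.range f) + Module.length R (LinearMap.ker f)
      = Module.length R V := by
  rw [add_comm]
  refine (Module.length_eq_add_of_exact (LinearMap.ker f).subtype f.rangeRestrict
    (Submodule.subtype_injective _) f.surjective_rangeRestrict ?_).symm
  rw [LinearMap.exact_iff, LinearMap.ker_rangeRestrict, Submodule.range_subtype]

/-- In a two-periodic complex of modules of the same finite length, exactness at one spot implies
exactness at the other. -/
theorem exact_of_exact_of_length_eq {R V W : Type*} [Ring R] [AddCommGroup V]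
    [AddCommGroup W] [Module R V] [Module R W] {A : V →ₗ[R] W} {B : W →ₗ[R] V}
    (hV : IsFiniteLength R V) (hVW : Module.length R V = Module.length R W)
    (hAB : A ∘ₗ B = 0) (h : Exact A B) : Exact B A := by
  have hV' := Module.length_ne_top_iff.mpr hV
  have hA := A.length_range_add_length_ker
  have hB := B.length_range_add_length_ker
  rw [← hVW, LinearMap.exact_iff.mp h, ← hA, add_comm] at hB
  have hrange : Module.length R (LinearMap.range A) ≠ ⊤ := fun htop ↦ by
    rw [htop, top_add] at hA; exact hV' hA.symm
  have hlen := ENat.add_right_injective_of_ne_top hrange hB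
  have hle : LinearMap.range B ≤ LinearMap.ker A := LinearMap.range_le_ker_iff.mpr hAB
  rw [LinearMap.exact_iff]
  obtain ⟨_, _⟩ := isFiniteLength_iff_isNoetherian_isArtinian.mp hV
  by_contra hne
  have hlt := Submodule.height_strictMono (lt_of_le_of_ne hle (Ne.symm hne))
  rw [← Module.length_submodule, ← Module.length_submodule, hlen] at hlt
  exact lt_irrefl _ hlt

/-! ### Two-periodic complexes with coefficients -/

section Periodic

variable {R : Type*} [CommRing R] {V W : Type*} [AddCommGroup V] [AddCommGroup W]
  [Module R V] [Module R W]

theorem LinearMap.rTensor_lTensor_apply {P Q S T : Type*} [AddCommGroup P] [AddCommGroup Q]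
    [AddCommGroup S] [AddCommGroup T] [Module R P] [Module R Q] [Module R S] [Module R T]
    (f : P →ₗ[R] Q) (g : S →ₗ[R] T) (t : P ⊗[R] S) :
    f.rTensor T (g.lTensor P t) = g.lTensor Q (f.rTensor S t) := by
  rw [← LinearMap.comp_apply, ← LinearMap.comp_apply, LinearMap.rTensor_comp_lTensor,
    LinearMap.lTensor_comp_rTensor]

theorem LinearMap.lTensor_lTensor_eq_zero {P Q S : Type*} [AddCommGroup P] [AddCommGroup Q]
    [AddCommGroup S] [Module R P] [Module R Q] [Module R S]
    {f : P →ₗ[R] Q} {g : Q →ₗ[R] S} (h : g ∘ₗ f = 0)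
    (X : Type*) [AddCommGroup X] [Module R X] (t : X ⊗[R] P) :
    g.lTensor X (f.lTensor X t) = 0 := by
  rw [← LinearMap.comp_apply, ← LinearMap.lTensor_comp, h, LinearMap.lTensor_zero,
    LinearMap.zero_apply]

variable {A : V →ₗ[R] W} {B : W →ₗ[R] V} {X : Type*} [AddCommGroup X] [Module R X]
  (L : Submodule R X) [Module.Flat R W] [Module.Flat R L]

/-- Exactness passes from coefficients `X` to coefficients `X ⧸ L` if `L` is flat. -/
theorem exact_lTensor_quotient (hAB : Exact A B) (hBA : Exact B A)
    (h : Exact (A.lTensor X) (B.lTensor X)) :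
    Exact (A.lTensor (X ⧸ L)) (B.lTensor (X ⧸ L)) := by
  intro c
  constructor
  · intro hc
    obtain ⟨x, rfl⟩ := LinearMap.rTensor_surjective W (Submodule.mkQ_surjective L) c
    rw [← LinearMap.rTensor_lTensor_apply] at hc
    obtain ⟨l, hl⟩ := (rTensor_exact V (LinearMap.exact_subtype_mkQ L)
      (Submodule.mkQ_surjective L) _).mp hc
    -- `l` represents the connecting homomorphism's value; it is a boundary since L is flat.
    have hl0 : A.lTensor L l = 0 := by
      apply Module.Flat.rTensor_preserves_injective_linearMap (M := W) L.subtype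
        (Submodule.subtype_injective L)
      rw [LinearMap.rTensor_lTensor_apply, hl, map_zero,
        LinearMap.lTensor_lTensor_eq_zero hBA.linearMap_comp_eq_zero]
    obtain ⟨m, rfl⟩ := (Module.Flat.lTensor_exact L hBA _).mp hl0
    rw [LinearMap.rTensor_lTensor_apply] at hl
    obtain ⟨y, hy⟩ := (h (x - L.subtype.rTensor W m)).mp (by rw [map_sub, hl, sub_self])
    refine ⟨L.mkQ.rTensor V y, ?_⟩
    rw [← LinearMap.rTensor_lTensor_apply, hy, map_sub,
      (rTensor_exact W (LinearMap.exact_subtype_mkQ L) (Submodule.mkQ_surjective L)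
        (L.subtype.rTensor W m)).mpr ⟨m, rfl⟩, sub_zero]
  · rintro ⟨y, rfl⟩
    exact LinearMap.lTensor_lTensor_eq_zero hAB.linearMap_comp_eq_zero _ _

/-- Exactness passes from coefficients `X ⧸ L` to coefficients `X` if `L` is flat. -/
theorem exact_lTensor_of_quotient (hBA : Exact B A)
    (h : Exact (B.lTensor (X ⧸ L)) (A.lTensor (X ⧸ L))) :
    Exact (B.lTensor X) (A.lTensor X) := by
  intro x
  constructor
  · intro hx
    obtain ⟨c, hc⟩ := (h (L.mkQ.rTensor V x)).mp (by
      rw [← LinearMap.rTensor_lTensor_apply, hx, map_zero])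
    obtain ⟨y, rfl⟩ := LinearMap.rTensor_surjective W (Submodule.mkQ_surjective L) c
    rw [← LinearMap.rTensor_lTensor_apply, ← sub_eq_zero, ← map_sub] at hc
    obtain ⟨l, hl⟩ := (rTensor_exact V (LinearMap.exact_subtype_mkQ L)
      (Submodule.mkQ_surjective L) _).mp hc
    have hl0 : A.lTensor L l = 0 := by
      apply Module.Flat.rTensor_preserves_injective_linearMap (M := W) L.subtype
        (Submodule.subtype_injective L)
      rw [LinearMap.rTensor_lTensor_apply, hl, map_zero, map_sub, hx, sub_zero,
        LinearMap.lTensor_lTensor_eq_zero hBA.linearMap_comp_eq_zero]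
    obtain ⟨m, rfl⟩ := (Module.Flat.lTensor_exact L hBA _).mp hl0
    refine ⟨y - L.subtype.rTensor W m, ?_⟩
    rw [map_sub, ← LinearMap.rTensor_lTensor_apply, hl, sub_sub_cancel]
  · rintro ⟨y, rfl⟩
    exact LinearMap.lTensor_lTensor_eq_zero hBA.linearMap_comp_eq_zero _ _

/-- Over a one-dimensional Noetherian domain, if one of the two homologies of a two-periodic exact
complex of flat modules with coefficients in a finitely generated module vanishes, then so does the
other. -/
theorem exact_lTensor_of_exact_lTensor [IsDomain R] [IsNoetherianRing R] [Ring.KrullDimLE 1 R]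
    [Module.Finite R V] [Module.Finite R X] (e : V ≃ₗ[R] W)
    (hAB : Exact A B) (hBA : Exact B A) (h : Exact (A.lTensor X) (B.lTensor X)) :
    Exact (B.lTensor X) (A.lTensor X) := by
  obtain ⟨L, _, c, hc, hL⟩ := exists_flat_submodule_smul_mem R X
  refine exact_lTensor_of_quotient L hBA ?_
  have hC : ∀ q : X ⧸ L, c • q = 0 := fun q ↦ by
    obtain ⟨x, rfl⟩ := Submodule.mkQ_surjective L q
    rw [← map_smul, Submodule.mkQ_apply, Submodule.Quotient.mk_eq_zero]
    exact hL x
  refine exact_of_exact_of_length_eq (isFiniteLength_of_forall_smul_eq_zero hc fun t ↦ ?_)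
    (e.lTensor (X ⧸ L)).length_eq ?_ (exact_lTensor_quotient L hAB hBA h)
  · induction t with
    | zero => exact smul_zero c
    | tmul q v => rw [TensorProduct.smul_tmul', hC, TensorProduct.zero_tmul]
    | add s t hs ht => rw [smul_add, hs, ht, add_zero]
  · rw [← LinearMap.lTensor_comp, hBA.linearMap_comp_eq_zero, LinearMap.lTensor_zero]

/-- The kernel of an injective map tensored with a finitely generated module over a domain is
torsion. -/
theorem mem_torsion_of_lTensor_eq_zero [IsDomain R] [Module.Finite R X] {M : Type*}
    [AddCommGroup M] [Module R M] {i : M →ₗ[R] V} (hi : Injective i) {t : X ⊗[R] M}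
    (ht : i.lTensor X t = 0) : t ∈ Submodule.torsion R (X ⊗[R] M) := by
  obtain ⟨L, _, c, hc, hL⟩ := exists_flat_submodule_smul_mem R X
  -- Multiplication by c on X factors through the flat module L, where tensoring preserves
  -- injectivity of `i`.
  let m : X →ₗ[R] L := (LinearMap.lsmul R X c).codRestrict L hL
  have hm : ∀ s : X ⊗[R] M, L.subtype.rTensor M (m.rTensor M s) = c • s := fun s ↦ by
    rw [← LinearMap.comp_apply, ← LinearMap.rTensor_comp]
    have : L.subtype ∘ₗ m = c • LinearMap.id := rfl
    rw [this, LinearMap.rTensor_smul, LinearMap.smul_apply, LinearMap.rTensor_id_apply]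
  have hmt : m.rTensor M t = 0 := by
    apply Module.Flat.lTensor_preserves_injective_linearMap (M := L) i hi
    rw [← LinearMap.rTensor_lTensor_apply, ht, map_zero, map_zero]
  rw [Submodule.mem_torsion_iff]
  refine ⟨⟨c, mem_nonZeroDivisors_of_ne_zero hc⟩, ?_⟩
  rw [Submonoid.mk_smul, ← hm, hmt, map_zero]

end Periodic

/-! ### Homomorphisms as tensors, minimality and rank -/

section DualTensor

variable {R : Type*} [CommRing R] {M : Type*} [AddCommGroup M] [Module R M]

theorem dualTensorHom_lTensor {P Q : Type*} [AddCommGroup P] [AddCommGroup Q] [Module R P]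
    [Module R Q] (f : P →ₗ[R] Q) (t : Module.Dual R M ⊗[R] P) :
    dualTensorHom R M Q (f.lTensor _ t) = f ∘ₗ dualTensorHom R M P t := by
  induction t with
  | zero => simp
  | tmul φ p => ext; simp
  | add s t hs ht => rw [map_add, map_add, hs, ht, map_add, LinearMap.comp_add]

theorem dualTensorHom_pi_bijective (ι : Type*) [Fintype ι] [DecidableEq ι] :
    Bijective (dualTensorHom R M (ι → R)) := by
  have key : ∀ t, dualTensorHom R M (ι → R) t
      = LinearMap.pi (TensorProduct.piScalarRight R R (Module.Dual R M) ι t) := fun t ↦ by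
    induction t with
    | zero => ext; simp
    | tmul φ p => ext; simp [mul_comm]
    | add s t hs ht => rw [map_add, map_add, hs, ht]; rfl
  constructor
  · intro s t hst
    rw [key, key] at hst
    apply (TensorProduct.piScalarRight R R (Module.Dual R M) ι).injective
    funext i
    ext x
    exact congrFun (LinearMap.congr_fun hst x) i
  · intro f
    refine ⟨(TensorProduct.piScalarRight R R (Module.Dual R M) ι).symm
      fun i ↦ LinearMap.proj i ∘ₗ f, ?_⟩
    rw [key, LinearEquiv.apply_symm_apply]
    rfl

end DualTensor

/-- A surjection from a finitely generated module over a local ring with kernel contained in the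
maximal ideal times the source is injective if it splits. -/
theorem ker_eq_bot_of_comp_eq_id {R : Type*} [CommRing R] [IsLocalRing R] {P M : Type*}
    [AddCommGroup P] [AddCommGroup M] [Module R P] [Module R M] [Module.Finite R P]
    {f : P →ₗ[R] M} {g : M →ₗ[R] P} (hfg : f ∘ₗ g = LinearMap.id)
    (hf : LinearMap.ker f ≤ IsLocalRing.maximalIdeal R • (⊤ : Submodule R P)) :
    LinearMap.ker f = ⊥ := by
  let p : P →ₗ[R] P := LinearMap.id - g ∘ₗ f
  have hfg' : ∀ x, f (g x) = x := LinearMap.congr_fun hfg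
  have hp : LinearMap.range p = LinearMap.ker f := by
    apply le_antisymm
    · rintro _ ⟨x, rfl⟩
      simp [p, hfg']
    · intro x hx
      exact ⟨x, by simp [p, LinearMap.mem_ker.mp hx]⟩
  refine Submodule.eq_bot_of_le_smul_of_le_jacobson_bot (IsLocalRing.maximalIdeal R) _ ?_ ?_
    (IsLocalRing.maximalIdeal_le_jacobson _)
  · rw [← hp, LinearMap.range_eq_map]
    exact Module.Finite.fg_top.map p
  -- `p` is a projection onto the kernel K, so K = p(K) ⊆ p(𝔪P) = 𝔪K, and Nakayama applies.
  · calc LinearMap.ker f = (LinearMap.ker f).map p := by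
          apply le_antisymm
          · intro x hx
            exact ⟨x, hx, by simp [p, LinearMap.mem_ker.mp hx]⟩
          · rw [← hp, LinearMap.range_eq_map]
            exact Submodule.map_mono le_top
      _ ≤ (IsLocalRing.maximalIdeal R • (⊤ : Submodule R P)).map p := Submodule.map_mono hf
      _ = IsLocalRing.maximalIdeal R • LinearMap.ker f := by
          rw [Submodule.map_smul'', ← LinearMap.range_eq_map, hp]

/-- Both ranks equal rank M + rank(im A), by additivity. -/
theorem finrank_eq_of_two_periodic {R : Type*} [CommRing R] [IsDomain R] {V W M : Type*}
    [AddCommGroup V] [AddCommGroup W] [AddCommGroup M] [Module R V] [Module R W] [Module R M]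
    [Module.Finite R V] [Module.Finite R W] {i : M →ₗ[R] V} {A : V →ₗ[R] W} {ε : W →ₗ[R] M}
    (hi : Injective i) (hiA : Exact i A) (hAε : Exact A ε) (hε : Surjective ε) :
    Module.finrank R V = Module.finrank R W := by
  have hV := (LinearMap.ker A).finrank_quotient_add_finrank
  have hW := (LinearMap.ker ε).finrank_quotient_add_finrank
  rw [(LinearMap.quotKerEquivRange A).finrank_eq, LinearMap.exact_iff.mp hiA,
    LinearMap.finrank_range_of_inj hi] at hV
  rw [(LinearMap.quotKerEquivOfSurjective ε hε).finrank_eq, LinearMap.exact_iff.mp hAε] at hW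
  rw [← hV, ← hW, add_comm]

theorem theorem1p2 {R : Type*} [CommRing R] [IsDomain R] [IsLocalRing R] [IsNoetherianRing R]
    (hdim : ringKrullDim R = 1)
    {M : Type*} [AddCommGroup M] [Module R M] [Module.Finite R M] [Nontrivial M]
    (hM : IsTwoPeriodic R M) :
    Submodule.torsion R (M ⊗[R] Module.Dual R M) ≠ ⊥ := by
  intro htors
  obtain ⟨F, ⟨e⟩⟩ := hM
  have : Ring.KrullDimLE 1 R := Ring.krullDimLE_iff.mpr hdim.le
  have : Module.Finite R (Module.Dual R M) := by
    refine Module.Finite.of_injective (LinearMap.lcomp R R F.ε) fun f g hfg ↦ ?_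
    exact LinearMap.cancel_right F.surjective_ε |>.mp hfg
  let i : M →ₗ[R] (Fin (F.rk 1) → R) := (LinearMap.range (F.d 1)).subtype ∘ₗ e.toLinearMap
  have hi : Injective i := (Submodule.subtype_injective _).comp e.injective
  have hirange : LinearMap.range i = LinearMap.range (F.d 1) := by
    rw [LinearMap.range_comp, LinearEquiv.range, Submodule.map_top, Submodule.range_subtype]
  have hiA : Exact i (F.d 0) := by
    rw [LinearMap.exact_iff, hirange]
    exact LinearMap.exact_iff.mp (F.exact_d 0)
  have hAB : Exact (F.d 0) (i ∘ₗ F.ε) := F.exact_ε.comp_injective i hi (map_zero i)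
  have hBA : Exact (i ∘ₗ F.ε) (F.d 0) := by
    rw [LinearMap.exact_iff, LinearMap.range_comp,
      LinearMap.range_eq_top.mpr F.surjective_ε, Submodule.map_top]
    exact LinearMap.exact_iff.mp hiA
  have hrk : F.rk 1 = F.rk 0 := by
    simpa using finrank_eq_of_two_periodic hi hiA F.exact_ε F.surjective_ε
  have hexact : Exact ((F.d 0).lTensor (Module.Dual R M))
      ((i ∘ₗ F.ε).lTensor (Module.Dual R M)) := by
    intro t
    constructor
    · intro ht
      rw [LinearMap.lTensor_comp, LinearMap.comp_apply] at ht
      refine (lTensor_exact _ F.exact_ε F.surjective_ε t).mp ?_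
      apply (TensorProduct.comm R (Module.Dual R M) M).injective
      rw [map_zero, ← Submodule.mem_bot R, ← htors]
      obtain ⟨a, ha⟩ := (Submodule.mem_torsion_iff _).mp (mem_torsion_of_lTensor_eq_zero hi ht)
      refine (Submodule.mem_torsion_iff _).mpr ⟨a, ?_⟩
      rw [Submonoid.smul_def] at ha ⊢
      rw [← map_smul, ha, map_zero]
    · rintro ⟨s, rfl⟩
      exact LinearMap.lTensor_lTensor_eq_zero hAB.linearMap_comp_eq_zero _ _
  have hexact' := exact_lTensor_of_exact_lTensor
    (LinearEquiv.funCongrLeft R R (finCongr hrk.symm)) hAB hBA hexact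
  -- View `i` as a cycle in M* ⊗ F₁.
  obtain ⟨t, ht⟩ := (dualTensorHom_pi_bijective (R := R) (M := M) (Fin (F.rk 1))).2 i
  obtain ⟨s, rfl⟩ := (hexact' t).mp (by
    apply (dualTensorHom_pi_bijective (R := R) (M := M) (Fin (F.rk 0))).1
    rw [dualTensorHom_lTensor, ht, hiA.linearMap_comp_eq_zero, map_zero])
  rw [dualTensorHom_lTensor] at ht
  have hsplit : F.ε ∘ₗ dualTensorHom R M _ s = LinearMap.id :=
    LinearMap.ext fun x ↦ hi (LinearMap.congr_fun ht x)
  have hker := ker_eq_bot_of_comp_eq_id hsplit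
    ((LinearMap.exact_iff.mp F.exact_ε).trans_le (F.minimal 0))
  rw [LinearMap.exact_iff.mp F.exact_ε, LinearMap.range_eq_bot] at hker
  -- Injectivity of ε forces A = 0, so F₁ = ker A = im i ⊆ 𝔪F₁.
  have htop : (⊤ : Submodule R (Fin (F.rk 1) → R)) = ⊥ := by
    refine Submodule.eq_bot_of_le_smul_of_le_jacobson_bot (IsLocalRing.maximalIdeal R) _
      Module.Finite.fg_top ?_ (IsLocalRing.maximalIdeal_le_jacobson _)
    have h1 := F.minimal 1
    rwa [← hirange, ← LinearMap.exact_iff.mp hiA, hker, LinearMap.ker_zero] at h1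
  obtain ⟨x, hx⟩ := exists_ne (0 : M)
  refine hx (hi ?_)
  rw [map_zero, ← Submodule.mem_bot R, ← htop]
  trivial
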